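/- **Proposition (the group $W_{3,1}$ limits only to singular groups among $W_{3,5/6}^{(a,b)}$).** Let $G=\mathrm{SL}_3(\mathbb R)$. A sequence of subgroups $H_n\le G$ converges to a subgroup $L\le G$ (in the Chabauty sense) if every $h\in L$ is a limit of some sequence $h_n\in H_n$, and whenever $h_n\in H_n$ for all $n$ and a subsequence $h_{n_k}$ converges to $h\in G$, then $h\in L$. A subgroup $L$ is a local limit of $H$ under conjugacy if there are $g_n\in G$ and a subgroup $L'\le G$ such that $g_nHg_n^{-1}\to L'$ and $L$ is the identity component of $L'$. Let $$W_{3,1}=\left\{\begin{pmatrix}p&0&d\\0&q&0\\0&0&r\end{pmatrix}: p,q,r>0,\ pqr=1,\ d\in\mathbb R\right\},$$ and for $(a,b)\in\mathbb R^2\setminus\{(0,0)\}$ let $$W_{3,5}^{(a,b)}=\left\{\begin{pmatrix}e^{at}&x&y\\0&e^{bt}&0\\0&0&e^{-(a+b)t}\end{pmatrix}: t,x,y\in\mathbb R\right\},\qquad W_{3,6}^{(a,b)}=\left\{\begin{pmatrix}e^{at}&0&x\\0&e^{bt}&y\\0&0&e^{-(a+b)t}\end{pmatrix}: t,x,y\in\mathbb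 R\right\}.$$ Call $(a,b)$ singular if at least two of the weights $a$, $b$, $-(a+b)$ are equal. For $t,s\in\mathbb R$ put $u(t,s)=I+tE_{12}+sE_{23}$. Then: 1. If $(a,b)\ne(0,0)$ and $W_{3,5}^{(a,b)}$ or $W_{3,6}^{(a,b)}$ is a local limit of $W_{3,1}$ under conjugacy, then $(a,b)$ is singular. 2. More precisely, for $(a,b)\neq(0,0)$, $W_{3,5}^{(a,b)}$ is a local limit of $W_{3,1}$ if and only if $a=b$ or $a=-(a+b)$, and $W_{3,6}^{(a,b)}$ is a local limit of $W_{3,1}$ if and only if $a=-(a+b)$ or $b=-(a+b)$. 3. Explicitly, for every $c\neq 0$, as $n\to\infty$, $u(n,0)\,W_{3,1}\,u(n,0)^{-1}\to W_{3,5}^{(c,c)}$ and $u(0,n)\,W_{3,1}\,u(0,n)^{-1}\to W_{3,6}^{(-2c,c)}$. 4. If $g_n\in G$ and $g_nW_{3,1}g_n^{-1}\to L$, then there are $k\in\mathrm{SO}(3)$ and real sequences $(t_n)$, $(s_n)$ such that $u(t_n,s_n)\,W_{3,1}\,u(t_n,s_n)^{-1}\to k^{-1}Lk$. 5. If $u(t_n,s_n)\,W_{3,1}\,u(t_n,s_n)^{-1}\to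 L$, then every $h\in L$ is upper triangular; if $(t_n)$ is unbounded, then $h_{11}=h_{22}$ for all $h\in L$; if $(s_n)$ is unbounded, then $h_{22}=h_{33}$ for all $h\in L$; and if both sequences are bounded, then $L$ is conjugate to $W_{3,1}$ in $G$. -/

import Mathlib

open Filter Topology

namespace SL3Limits

/-- The Lie group `SL₃(ℝ)`, with its usual topology as a space of matrices. -/
abbrev G : Type := Matrix.SpecialLinearGroup (Fin 3) ℝ

/-- The conjugate subgroup `g H g⁻¹`. -/
def conj (g : G) (H : Subgroup G) : Subgroup G := H.map (MulAut.conj g).toMonoidHom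

/-- Convergence `Hₙ → L` of a sequence of subgroups in the Chabauty topology: every element of `L`
is a limit of elements of the `Hₙ`, and every limit of a convergent subsequence of a sequence
`hₙ ∈ Hₙ` lies in `L`. -/
def ChabautyTendsto (H : ℕ → Subgroup G) (L : Subgroup G) : Prop :=
  (∀ x ∈ L, ∃ h : ℕ → G, (∀ n, h n ∈ H n) ∧ Tendsto h atTop (𝓝 x)) ∧
  (∀ h : ℕ → G, (∀ n, h n ∈ H n) → ∀ φ : ℕ → ℕ, StrictMono φ →
    ∀ x : G, Tendsto (fun k => h (φ k)) atTop (𝓝 x) → x ∈ L)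

/-- `L` is a local limit of `H` under conjugacy: some sequence of conjugates `gₙ H gₙ⁻¹` converges
to a subgroup `L'` whose identity component is `L`. -/
def IsLocalLimit (H L : Subgroup G) : Prop :=
  ∃ (g : ℕ → G) (L' : Subgroup G),
    ChabautyTendsto (fun n => conj (g n) H) L' ∧
    (L : Set G) = connectedComponentIn (L' : Set G) 1

/-- The connected group `W_{3,1}` (the image under `exp` of its Lie algebra, so that the diagonal
entries are positive). -/
def W31 : Subgroup G where
  carrier := {M | ∃ p q r d : ℝ, 0 < p ∧ 0 < q ∧ 0 < r ∧
    (M : Matrix (Fin 3) (Fin 3) ℝ) = !![p, 0, d; 0, q, 0; 0, 0, r]}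
  one_mem' := ⟨1, 1, 1, 0, by norm_num, by norm_num, by norm_num, by
    rw [Matrix.SpecialLinearGroup.coe_one, Matrix.one_fin_three]⟩
  mul_mem' := by
    rintro A B ⟨p, q, r, d, hp, hq, hr, hA⟩ ⟨p', q', r', d', hp', hq', hr', hB⟩
    refine ⟨p * p', q * q', r * r', p * d' + d * r', by positivity, by positivity, by positivity, ?_⟩
    rw [Matrix.SpecialLinearGroup.coe_mul, hA, hB]
    ext i j
    fin_cases i <;> fin_cases j <;> simp [Matrix.mul_apply, Fin.sum_univ_three]
  inv_mem' := by
    rintro A ⟨p, q, r, d, hp, hq, hr, hA⟩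
    refine ⟨q * r, p * r, p * q, -(d * q), by positivity, by positivity, by positivity, ?_⟩
    rw [Matrix.SpecialLinearGroup.coe_inv, hA, Matrix.adjugate_fin_three]
    ext i j
    fin_cases i <;> fin_cases j <;> simp

/-- The group `W_{3,5}^{(a,b)}`. -/
def W35 (a b : ℝ) : Subgroup G where
  carrier := {M | ∃ t x y : ℝ, (M : Matrix (Fin 3) (Fin 3) ℝ) =
    !![Real.exp (a * t), x, y; 0, Real.exp (b * t), 0; 0, 0, Real.exp (-(a + b) * t)]}
  one_mem' := ⟨0, 0, 0, by
    rw [Matrix.SpecialLinearGroup.coe_one, Matrix.one_fin_three]; simp⟩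
  mul_mem' := by
    rintro A B ⟨t, x, y, hA⟩ ⟨t', x', y', hB⟩
    refine ⟨t + t', Real.exp (a * t) * x' + x * Real.exp (b * t'),
      Real.exp (a * t) * y' + y * Real.exp (-(a + b) * t'), ?_⟩
    rw [Matrix.SpecialLinearGroup.coe_mul, hA, hB]
    ext i j
    fin_cases i <;> fin_cases j <;>
      simp [Matrix.mul_apply, Fin.sum_univ_three, mul_add, Real.exp_add]
  inv_mem' := by
    rintro A ⟨t, x, y, hA⟩
    refine ⟨-t, -(x * Real.exp (-(a + b) * t)), -(Real.exp (b * t) * y), ?_⟩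
    rw [Matrix.SpecialLinearGroup.coe_inv, hA, Matrix.adjugate_fin_three]
    ext i j
    fin_cases i <;> fin_cases j <;> simp [← Real.exp_add] <;> ring_nf

/-- The group `W_{3,6}^{(a,b)}`. -/
def W36 (a b : ℝ) : Subgroup G where
  carrier := {M | ∃ t x y : ℝ, (M : Matrix (Fin 3) (Fin 3) ℝ) =
    !![Real.exp (a * t), 0, x; 0, Real.exp (b * t), y; 0, 0, Real.exp (-(a + b) * t)]}
  one_mem' := ⟨0, 0, 0, by
    rw [Matrix.SpecialLinearGroup.coe_one, Matrix.one_fin_three]; simp⟩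
  mul_mem' := by
    rintro A B ⟨t, x, y, hA⟩ ⟨t', x', y', hB⟩
    refine ⟨t + t', Real.exp (a * t) * x' + x * Real.exp (-(a + b) * t'),
      Real.exp (b * t) * y' + y * Real.exp (-(a + b) * t'), ?_⟩
    rw [Matrix.SpecialLinearGroup.coe_mul, hA, hB]
    ext i j
    fin_cases i <;> fin_cases j <;>
      simp [Matrix.mul_apply, Fin.sum_univ_three, mul_add, Real.exp_add]
  inv_mem' := by
    rintro A ⟨t, x, y, hA⟩
    refine ⟨-t, -(x * Real.exp (b * t)), -(Real.exp (a * t) * y), ?_⟩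
    rw [Matrix.SpecialLinearGroup.coe_inv, hA, Matrix.adjugate_fin_three]
    ext i j
    fin_cases i <;> fin_cases j <;> simp [← Real.exp_add] <;> ring_nf

/-- `(a, b)` is singular: two of the three weights `a`, `b`, `-(a + b)` are equal. -/
def IsSingular (a b : ℝ) : Prop := a = b ∨ a = -(a + b) ∨ b = -(a + b)

/-- The unipotent matrix `I + t E₁₂ + s E₂₃`. -/
def unip (t s : ℝ) : G := ⟨!![1, t, 0; 0, 1, s; 0, 0, 1], by simp [Matrix.det_fin_three]⟩

end SL3Limits

namespace SL3Limits

/-! The Iwasawa decomposition reduces everything to unipotent conjugators. An upper triangular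
matrix of determinant one with positive diagonal is `unip t s` times an element of `W31`, so every
conjugate of `W31` is a rotation of some `unip t s` conjugate (`exists_conj_eq_conj_unip`). The
rotations converge along a subsequence by compactness.

The conjugate by `unip t s` consists of the upper triangular matrices with positive diagonal that
satisfy `h 0 1 = t * (h 1 1 - h 0 0)` and `h 1 2 = s * (h 2 2 - h 1 1)`. In a limit, an unbounded
`t` forces `h 0 0 = h 1 1`, while a bounded `t` forces `h 0 1 = 0` wherever those two entries agree;
`s` controls the second equation in the same way.

Let a limit contain a conjugate of `W35 a b`. If `t` is bounded, the unipotents `I + E₁₂` and `I +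
E₁₃` fix two independent vectors whose span is too large for their common fixed line
(`not_W35_of_entry_eq_zero`). So `t` is unbounded and the weight `a` of that line is a double weight
(`weights_of_W35`). `W36` is dual: row vectors replace columns, and `s` replaces `t`. Conversely,
the sequences `unip n 0` and `unip 0 n` realize one singular group of each type, and signed
permutations give the others. -/

lemma mem_conj_iff {g h : G} {H : Subgroup G} : h ∈ conj g H ↔ g⁻¹ * h * g ∈ H := by
  constructor
  · rintro ⟨w, hw, rfl⟩
    simpa [mul_assoc] using hw
  · intro hw
    exact ⟨_, hw, by simp [mul_assoc]⟩

lemma conj_conj (g k : G) (H : Subgroup G) : conj g (conj k H) = conj (g * k) H := by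
  ext h
  simp [mem_conj_iff, mul_assoc]

lemma conj_of_mem {g : G} {H : Subgroup G} (hg : g ∈ H) : conj g H = H := by
  ext h
  rw [mem_conj_iff, Subgroup.mul_mem_cancel_right _ hg,
    Subgroup.mul_mem_cancel_left _ (H.inv_mem hg)]

lemma tendsto_iff_entries {ι : Type*} {l : Filter ι} {f : ι → G} {x : G} :
    Tendsto f l (𝓝 x) ↔ ∀ i j, Tendsto (fun n => f n i j) l (𝓝 (x i j)) := by
  refine Matrix.SpecialLinearGroup.isClosedEmbedding_val.isEmbedding.tendsto_nhds_iff.trans ?_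
  exact tendsto_pi_nhds.trans (forall_congr' fun i => tendsto_pi_nhds)

lemma det_of_upper {h : G} (h10 : h 1 0 = 0) (h20 : h 2 0 = 0) (h21 : h 2 1 = 0) :
    h 0 0 * h 1 1 * h 2 2 = 1 := by
  have := h.det_coe
  rw [Matrix.det_fin_three, h10, h20, h21] at this
  linarith

/-! ### Chabauty convergence: uniqueness, subsequences, conjugation -/

namespace ChabautyTendsto

variable {H : ℕ → Subgroup G} {L L' : Subgroup G}

lemma mem_of_tendsto (hL : ChabautyTendsto H L) {h : ℕ → G} (hh : ∀ n, h n ∈ H n) {x : G}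
    (hx : Tendsto h atTop (𝓝 x)) : x ∈ L :=
  hL.2 h hh id strictMono_id x hx

lemma unique (hL : ChabautyTendsto H L) (hL' : ChabautyTendsto H L') : L = L' := by
  ext x
  constructor
  · intro hx
    obtain ⟨h, hh, hx⟩ := hL.1 x hx
    exact hL'.mem_of_tendsto hh hx
  · intro hx
    obtain ⟨h, hh, hx⟩ := hL'.1 x hx
    exact hL.mem_of_tendsto hh hx

/-- It suffices to approximate by elements that eventually lie in the groups, and to know that
limits along arbitrary subsequences of the groups belong to the limit. -/
lemma of_eventually
    (h₁ : ∀ x ∈ L, ∃ h : ℕ → G, (∀ᶠ n in atTop, h n ∈ H n) ∧ Tendsto h atTop (𝓝 x))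
    (h₂ : ∀ φ : ℕ → ℕ, StrictMono φ → ∀ h : ℕ → G, (∀ n, h n ∈ H (φ n)) → ∀ x,
      Tendsto h atTop (𝓝 x) → x ∈ L) : ChabautyTendsto H L := by
  classical
  refine ⟨fun x hx => ?_, fun h hh φ hφ x hx => h₂ φ hφ _ (fun n => hh (φ n)) x hx⟩
  obtain ⟨h, hh, hx⟩ := h₁ x hx
  -- The identity lies in every subgroup, so it serves as the value at the finitely many bad
  -- indices.
  refine ⟨fun n => if h n ∈ H n then h n else 1, fun n => ?_, hx.congr' ?_⟩
  · dsimp only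
    split_ifs with hn
    · exact hn
    · exact one_mem _
  · filter_upwards [hh] with n hn
    rw [if_pos hn]

lemma mem_of_tendsto_subseq (hL : ChabautyTendsto H L) {φ : ℕ → ℕ} (hφ : StrictMono φ)
    {h : ℕ → G} (hh : ∀ n, h n ∈ H (φ n)) {x : G} (hx : Tendsto h atTop (𝓝 x)) : x ∈ L := by
  classical
  -- The definition wants a sequence indexed by all of `ℕ`; off the range of `φ` it is filled with
  -- the identity.
  have key : ∀ m, Function.extend φ h (fun _ => 1) m ∈ H m := by
    intro m
    by_cases hm : ∃ n, φ n = m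
    · obtain ⟨n, rfl⟩ := hm
      rw [hφ.injective.extend_apply]
      exact hh n
    · rw [Function.extend_apply' _ _ _ hm]
      exact one_mem _
  refine hL.2 _ key φ hφ x ?_
  simpa only [hφ.injective.extend_apply] using hx

lemma comp_strictMono (hL : ChabautyTendsto H L) {φ : ℕ → ℕ} (hφ : StrictMono φ) :
    ChabautyTendsto (fun n => H (φ n)) L := by
  refine ⟨fun x hx => ?_, fun h hh ψ hψ x hx => ?_⟩
  · obtain ⟨h, hh, hx⟩ := hL.1 x hx
    exact ⟨_, fun n => hh (φ n), hx.comp hφ.tendsto_atTop⟩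
  · exact hL.mem_of_tendsto_subseq (hφ.comp hψ) (fun n => hh (ψ n)) hx

/-- The conjugators may vary with `n` because the rotations of the Iwasawa decomposition do. -/
lemma conj (hL : ChabautyTendsto H L) {k : ℕ → G} {k₀ : G} (hk : Tendsto k atTop (𝓝 k₀)) :
    ChabautyTendsto (fun n => SL3Limits.conj (k n) (H n)) (SL3Limits.conj k₀ L) := by
  refine ⟨fun x hx => ?_, fun h hh φ hφ x hx => ?_⟩
  · obtain ⟨h, hh, hx⟩ := hL.1 _ (mem_conj_iff.1 hx)
    refine ⟨fun n => k n * h n * (k n)⁻¹, fun n => ?_, ?_⟩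
    · rw [mem_conj_iff]
      simpa [mul_assoc] using hh n
    · simpa [mul_assoc] using (hk.mul hx).mul hk.inv
  · rw [mem_conj_iff]
    have hk' := hk.comp hφ.tendsto_atTop
    exact hL.2 (fun n => (k n)⁻¹ * h n * k n) (fun n => mem_conj_iff.1 (hh n)) φ hφ _
      ((hk'.inv.mul hx).mul hk')

end ChabautyTendsto

lemma ChabautyTendsto.const {L : Subgroup G} (hL : IsClosed (L : Set G)) :
    ChabautyTendsto (fun _ => L) L :=
  ⟨fun x hx => ⟨fun _ => x, fun _ => hx, tendsto_const_nhds⟩, fun _ hh _ _ _ hx =>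
    hL.mem_of_tendsto hx (Eventually.of_forall fun _ => hh _)⟩

/-! ### Equations for `W31` and its unipotent conjugates -/

lemma mem_W31_iff {h : G} : h ∈ W31 ↔ 0 < h 0 0 ∧ 0 < h 1 1 ∧ 0 < h 2 2 ∧ h 1 0 = 0 ∧ h 2 0 = 0 ∧
    h 2 1 = 0 ∧ h 0 1 = 0 ∧ h 1 2 = 0 := by
  constructor
  · rintro ⟨p, q, r, d, hp, hq, hr, hM⟩
    simp [hM, hp, hq, hr]
  · rintro ⟨hp, hq, hr, h10, h20, h21, h01, h12⟩
    refine ⟨_, _, _, h 0 2, hp, hq, hr, ?_⟩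
    ext i j
    fin_cases i <;> fin_cases j <;> simp [*]

lemma coe_unip (t s : ℝ) :
    (unip t s : Matrix (Fin 3) (Fin 3) ℝ) = !![1, t, 0; 0, 1, s; 0, 0, 1] := rfl

lemma coe_unip_inv (t s : ℝ) :
    ((unip t s)⁻¹ : G).1 = !![1, -t, t * s; 0, 1, -s; 0, 0, 1] := by
  rw [Matrix.SpecialLinearGroup.coe_inv, coe_unip, Matrix.adjugate_fin_three]
  ext i j
  fin_cases i <;> fin_cases j <;> simp

/-- For upper triangular `h`, the two equations say that the superdiagonal of `u⁻¹ h u` vanishes.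
They are linear in `h`, hence easy to follow to the limit. -/
lemma mem_conj_unip_iff {t s : ℝ} {h : G} : h ∈ conj (unip t s) W31 ↔
    0 < h 0 0 ∧ 0 < h 1 1 ∧ 0 < h 2 2 ∧ h 1 0 = 0 ∧ h 2 0 = 0 ∧ h 2 1 = 0 ∧
      h 0 1 = t * (h 1 1 - h 0 0) ∧ h 1 2 = s * (h 2 2 - h 1 1) := by
  rw [mem_conj_iff, mem_W31_iff]
  simp only [Matrix.SpecialLinearGroup.coe_mul, coe_unip_inv, coe_unip, Matrix.mul_apply,
    Fin.sum_univ_three]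
  simp
  constructor
  · rintro ⟨h1, h2, h3, h4, h5, h6, h7, h8⟩
    simp only [h5, mul_zero, add_zero, zero_mul, zero_add, neg_zero] at h1 h2 h3 h4 h6 h7 h8
    simp only [h4, h6, mul_zero, add_zero, zero_mul, zero_add, neg_zero] at h1 h2 h3 h7 h8
    exact ⟨h1, h2, h3, h4, h5, h6, by linarith, by linarith⟩
  · rintro ⟨h1, h2, h3, h4, h5, h6, h7, h8⟩
    simp only [h4, h5, h6, h7, h8]
    refine ⟨by simpa, by simpa, by simpa, by simp, trivial, by simp, by ring, by ring⟩

/-- The strict inequalities may be relaxed to `≤`: the diagonal entries have product one, so none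
can vanish. -/
lemma isClosed_W31 : IsClosed (W31 : Set G) := by
  have hc : ∀ i j, Continuous fun h : G => h i j := fun i j =>
    (continuous_apply_apply i j).comp continuous_subtype_val
  have : (W31 : Set G) = {h : G | 0 ≤ h 0 0 ∧ 0 ≤ h 1 1 ∧ 0 ≤ h 2 2 ∧ h 1 0 = 0 ∧ h 2 0 = 0 ∧
      h 2 1 = 0 ∧ h 0 1 = 0 ∧ h 1 2 = 0} := by
    ext h
    simp only [SetLike.mem_coe, mem_W31_iff, Set.mem_ofPred_eq]
    constructor
    · rintro ⟨h1, h2, h3, h⟩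
      exact ⟨h1.le, h2.le, h3.le, h⟩
    · rintro ⟨h1, h2, h3, h4, h5, h6, h⟩
      have hd := det_of_upper h4 h5 h6
      refine ⟨h1.lt_of_ne' ?_, h2.lt_of_ne' ?_, h3.lt_of_ne' ?_, h4, h5, h6, h⟩ <;>
      · intro h0
        simp [h0] at hd
  rw [this]
  refine .and ?_ (.and ?_ (.and ?_ (.and ?_ (.and ?_ (.and ?_ (.and ?_ ?_))))))
  all_goals first
    | exact isClosed_le continuous_const (hc _ _)
    | exact isClosed_eq (hc _ _) continuous_const

/-! ### Limits along unipotent conjugators: bounded versus unbounded parameters -/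

section UnipotentLimits

variable {t s : ℕ → ℝ} {L : Subgroup G}

lemma upper_of_unip_limit
    (hL : ChabautyTendsto (fun n => conj (unip (t n) (s n)) W31) L) {h : G} (hh : h ∈ L) :
    h 1 0 = 0 ∧ h 2 0 = 0 ∧ h 2 1 = 0 := by
  obtain ⟨f, hf, hx⟩ := hL.1 h hh
  rw [tendsto_iff_entries] at hx
  have hf' := fun n => mem_conj_unip_iff.1 (hf n)
  refine ⟨tendsto_nhds_unique (hx 1 0) ?_, tendsto_nhds_unique (hx 2 0) ?_,
    tendsto_nhds_unique (hx 2 1) ?_⟩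
  · simp [fun n => (hf' n).2.2.2.1]
  · simp [fun n => (hf' n).2.2.2.2.1]
  · simp [fun n => (hf' n).2.2.2.2.2.1]

lemma exists_tendsto_entries
    (hL : ChabautyTendsto (fun n => conj (unip (t n) (s n)) W31) L) {h : G} (hh : h ∈ L) :
    (∃ D : ℕ → ℝ, Tendsto D atTop (𝓝 (h 1 1 - h 0 0)) ∧
      Tendsto (fun n => t n * D n) atTop (𝓝 (h 0 1))) ∧
    (∃ D : ℕ → ℝ, Tendsto D atTop (𝓝 (h 2 2 - h 1 1)) ∧
      Tendsto (fun n => s n * D n) atTop (𝓝 (h 1 2))) := by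
  obtain ⟨f, hf, hx⟩ := hL.1 h hh
  rw [tendsto_iff_entries] at hx
  have hf' := fun n => mem_conj_unip_iff.1 (hf n)
  refine ⟨⟨_, (hx 1 1).sub (hx 0 0), ?_⟩, ⟨_, (hx 2 2).sub (hx 1 1), ?_⟩⟩
  · exact (hx 0 1).congr fun n => (hf' n).2.2.2.2.2.2.1
  · exact (hx 1 2).congr fun n => (hf' n).2.2.2.2.2.2.2

/-- `u` is eventually the quotient `(u * D) / D` of convergent sequences, so it converges. In
contrapositive form this covers unbounded sequences that do not tend to infinity. -/
lemma isBounded_range_of_tendsto_mul {u D : ℕ → ℝ} {x d : ℝ} (hD : Tendsto D atTop (𝓝 d))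
    (hd : d ≠ 0) (hu : Tendsto (fun n => u n * D n) atTop (𝓝 x)) :
    Bornology.IsBounded (Set.range u) := by
  have h : Tendsto u atTop (𝓝 (x / d)) := by
    refine (hu.div hD hd).congr' ?_
    filter_upwards [hD.eventually_ne hd] with n hn
    exact mul_div_cancel_right₀ _ hn
  exact Metric.isBounded_range_of_tendsto _ h

lemma eq_zero_of_tendsto_mul {u D : ℕ → ℝ} {x : ℝ} (hD : Tendsto D atTop (𝓝 0))
    (hu : Bornology.IsBounded (Set.range u)) (hx : Tendsto (fun n => u n * D n) atTop (𝓝 x)) :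
    x = 0 := by
  obtain ⟨C, hC⟩ := hu.exists_norm_le
  refine tendsto_nhds_unique hx (squeeze_zero_norm (a := fun n => C * ‖D n‖) (fun n => ?_) ?_)
  · rw [norm_mul]
    gcongr
    exact hC _ ⟨n, rfl⟩
  · simpa using hD.norm.const_mul C

lemma entry_eq_of_unbounded_left
    (hL : ChabautyTendsto (fun n => conj (unip (t n) (s n)) W31) L)
    (ht : ¬ Bornology.IsBounded (Set.range t)) {h : G} (hh : h ∈ L) : h 0 0 = h 1 1 := by
  obtain ⟨D, hD, hx⟩ := (exists_tendsto_entries hL hh).1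
  by_contra hne
  exact ht (isBounded_range_of_tendsto_mul hD (sub_ne_zero.2 (Ne.symm hne)) hx)

lemma entry_eq_of_unbounded_right
    (hL : ChabautyTendsto (fun n => conj (unip (t n) (s n)) W31) L)
    (hs : ¬ Bornology.IsBounded (Set.range s)) {h : G} (hh : h ∈ L) : h 1 1 = h 2 2 := by
  obtain ⟨D, hD, hx⟩ := (exists_tendsto_entries hL hh).2
  by_contra hne
  exact hs (isBounded_range_of_tendsto_mul hD (sub_ne_zero.2 (Ne.symm hne)) hx)

lemma entry_eq_zero_of_bounded_left
    (hL : ChabautyTendsto (fun n => conj (unip (t n) (s n)) W31) L)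
    (ht : Bornology.IsBounded (Set.range t)) {h : G} (hh : h ∈ L) (he : h 0 0 = h 1 1) :
    h 0 1 = 0 := by
  obtain ⟨D, hD, hx⟩ := (exists_tendsto_entries hL hh).1
  rw [he, sub_self] at hD
  exact eq_zero_of_tendsto_mul hD ht hx

lemma entry_eq_zero_of_bounded_right
    (hL : ChabautyTendsto (fun n => conj (unip (t n) (s n)) W31) L)
    (hs : Bornology.IsBounded (Set.range s)) {h : G} (hh : h ∈ L) (he : h 1 1 = h 2 2) :
    h 1 2 = 0 := by
  obtain ⟨D, hD, hx⟩ := (exists_tendsto_entries hL hh).2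
  rw [he, sub_self] at hD
  exact eq_zero_of_tendsto_mul hD hs hx

lemma tendsto_unip {t s : ℕ → ℝ} {t₀ s₀ : ℝ} (ht : Tendsto t atTop (𝓝 t₀))
    (hs : Tendsto s atTop (𝓝 s₀)) :
    Tendsto (fun n => unip (t n) (s n)) atTop (𝓝 (unip t₀ s₀)) := by
  rw [tendsto_iff_entries]
  intro i j
  fin_cases i <;> fin_cases j <;> simp [coe_unip, ht, hs]

/-- Bolzano–Weierstrass makes the conjugators converge along a subsequence; since `W31` is closed,
its conjugates then converge to a conjugate, and Chabauty limits are unique. -/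
lemma exists_eq_conj_of_bounded
    (hL : ChabautyTendsto (fun n => conj (unip (t n) (s n)) W31) L)
    (ht : Bornology.IsBounded (Set.range t)) (hs : Bornology.IsBounded (Set.range s)) :
    ∃ p : G, L = conj p W31 := by
  obtain ⟨t₀, -, φ, hφ, ht₀⟩ := tendsto_subseq_of_bounded ht (fun n => Set.mem_range_self n)
  obtain ⟨s₀, -, ψ, hψ, hs₀⟩ := tendsto_subseq_of_bounded
    (hs.subset (Set.range_comp_subset_range φ s)) (fun n => Set.mem_range_self n)
  have hlim := tendsto_unip (ht₀.comp hψ.tendsto_atTop) hs₀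
  exact ⟨_, (hL.comp_strictMono (hφ.comp hψ)).unique
    ((ChabautyTendsto.const isClosed_W31).conj hlim)⟩

end UnipotentLimits

/-! ### The explicit limits along `unip n 0` and `unip 0 n` -/

section Explicit

/-- The parameter is recovered as `log (h 0 0) / c`, and the determinant fixes the last entry. The
conditions do not involve `c`, so one sequence of conjugates serves every `c ≠ 0`. -/
lemma mem_W35_self_iff {c : ℝ} (hc : c ≠ 0) {h : G} : h ∈ W35 c c ↔
    0 < h 0 0 ∧ h 1 1 = h 0 0 ∧ h 1 0 = 0 ∧ h 2 0 = 0 ∧ h 2 1 = 0 ∧ h 1 2 = 0 := by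
  constructor
  · rintro ⟨u, x, y, hM⟩
    simp [hM, Real.exp_pos]
  · rintro ⟨hp, hq, h10, h20, h21, h12⟩
    have hd := det_of_upper h10 h20 h21
    have he : Real.exp (c * (Real.log (h 0 0) / c)) = h 0 0 := by
      rw [mul_div_cancel₀ _ hc, Real.exp_log hp]
    have he' : Real.exp (-(c + c) * (Real.log (h 0 0) / c)) = h 2 2 := by
      have : -(c + c) * (Real.log (h 0 0) / c) = -(Real.log (h 0 0) + Real.log (h 0 0)) := by
        field_simp
      rw [this, Real.exp_neg, Real.exp_add, Real.exp_log hp]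
      rw [hq] at hd
      exact (eq_inv_of_mul_eq_one_right hd).symm
    refine ⟨Real.log (h 0 0) / c, h 0 1, h 0 2, ?_⟩
    rw [he, he']
    ext i j
    fin_cases i <;> fin_cases j <;> simp [*]

lemma mem_W36_self_iff {c : ℝ} (hc : c ≠ 0) {h : G} : h ∈ W36 (-2 * c) c ↔
    0 < h 1 1 ∧ h 2 2 = h 1 1 ∧ h 1 0 = 0 ∧ h 2 0 = 0 ∧ h 2 1 = 0 ∧ h 0 1 = 0 := by
  constructor
  · rintro ⟨u, x, y, hM⟩
    simp only [hM]
    simp only [Matrix.of_apply, Matrix.cons_val, and_self, and_true]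
    exact ⟨Real.exp_pos _, by ring_nf⟩
  · rintro ⟨hp, hq, h10, h20, h21, h01⟩
    have hd := det_of_upper h10 h20 h21
    have he : Real.exp (c * (Real.log (h 1 1) / c)) = h 1 1 := by
      rw [mul_div_cancel₀ _ hc, Real.exp_log hp]
    have he' : Real.exp (-2 * c * (Real.log (h 1 1) / c)) = h 0 0 := by
      have : -2 * c * (Real.log (h 1 1) / c) = -(Real.log (h 1 1) + Real.log (h 1 1)) := by
        field_simp
        ring
      rw [this, Real.exp_neg, Real.exp_add, Real.exp_log hp]
      rw [hq, mul_assoc] at hd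
      exact (eq_inv_of_mul_eq_one_left hd).symm
    refine ⟨Real.log (h 1 1) / c, h 0 2, h 1 2, ?_⟩
    have : -(-2 * c + c) = c := by ring
    rw [this, he, he']
    ext i j
    fin_cases i <;> fin_cases j <;> simp [*]

lemma tendsto_add_div_natCast (p x : ℝ) :
    Tendsto (fun n : ℕ => p + x / n) atTop (𝓝 p) := by
  simpa using (tendsto_const_div_atTop_nhds_zero_nat x).const_add p

lemma pos_of_upper_limit {f : ℕ → G} {x : G}
    (hx : ∀ i j, Tendsto (fun n => f n i j) atTop (𝓝 (x i j)))
    (hf : ∀ n i, 0 < f n i i) (h10 : x 1 0 = 0) (h20 : x 2 0 = 0) (h21 : x 2 1 = 0) (i : Fin 3) :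
    0 < x i i := by
  have hd := det_of_upper h10 h20 h21
  refine (ge_of_tendsto' (hx i i) fun n => (hf n i).le).lt_of_ne' fun h0 => ?_
  fin_cases i <;> simp at h0 <;> simp [h0] at hd

lemma eq_zero_of_mul_tendsto {φ : ℕ → ℕ} (hφ : StrictMono φ) {D : ℕ → ℝ} {d x : ℝ}
    (hD : Tendsto D atTop (𝓝 d)) (hx : Tendsto (fun n => (φ n : ℝ) * D n) atTop (𝓝 x)) :
    d = 0 := by
  have hφ' : Tendsto (fun n => (φ n : ℝ)) atTop atTop :=
    tendsto_natCast_atTop_atTop.comp hφ.tendsto_atTop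
  refine tendsto_nhds_unique hD ((hx.div_atTop hφ').congr' ?_)
  filter_upwards [hφ'.eventually_ne_atTop 0] with n hn
  exact mul_div_cancel_left₀ _ hn

lemma tendsto_unip_left {c : ℝ} (hc : c ≠ 0) :
    ChabautyTendsto (fun n : ℕ => conj (unip n 0) W31) (W35 c c) := by
  refine .of_eventually (fun h hh => ?_) (fun φ hφ f hf h hx => ?_)
  · rw [mem_W35_self_iff hc] at hh
    obtain ⟨hp, hq, h10, h20, h21, h12⟩ := hh
    have hd := det_of_upper h10 h20 h21
    obtain ⟨p, hpdef⟩ : ∃ p, h 0 0 = p := ⟨_, rfl⟩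
    rw [hpdef] at hp hq hd
    -- Perturbing the second diagonal entry by `h 0 1 / n` makes `n * (h 1 1 - h 0 0)` equal to the
    -- wanted entry `h 0 1`; the third entry is then forced by the determinant. Positivity holds for
    -- large `n`.
    have key : ∀ n : ℕ, ∃ g : G, 0 < p + h 0 1 / n → (g : Matrix (Fin 3) (Fin 3) ℝ) =
        !![p, h 0 1, h 0 2; 0, p + h 0 1 / n, 0; 0, 0, (p * (p + h 0 1 / n))⁻¹] := by
      intro n
      by_cases hn : 0 < p + h 0 1 / n
      · exact ⟨⟨_, by simp [Matrix.det_fin_three]; field_simp⟩, fun _ => rfl⟩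
      · exact ⟨1, fun h => absurd h hn⟩
    choose f hf using key
    have hlim := tendsto_add_div_natCast p (h 0 1)
    have hpos := hlim.eventually_const_lt hp
    refine ⟨f, ?_, ?_⟩
    · filter_upwards [hpos, eventually_ne_atTop 0] with n hn hn0
      rw [mem_conj_unip_iff, hf n hn]
      have : (n : ℝ) ≠ 0 := by exact_mod_cast hn0
      simp [hp, hn]
      field_simp
    · rw [tendsto_iff_entries]
      intro i j
      refine Tendsto.congr' (f₁ := fun n : ℕ => !![p, h 0 1, h 0 2; 0, p + h 0 1 / n, 0;
        0, 0, (p * (p + h 0 1 / n))⁻¹] i j) (hpos.mono fun n hn => ?_) ?_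
      · dsimp only
        rw [hf n hn]
      · have h22 : h 2 2 = (p * p)⁻¹ := by
          rw [hq] at hd
          exact eq_inv_of_mul_eq_one_right hd
        have := (hlim.const_mul p).inv₀ (by positivity)
        fin_cases i <;> fin_cases j <;> simp only [Fin.zero_eta, Fin.mk_one, Fin.reduceFinMk,
          Matrix.of_apply, Matrix.cons_val, h10, h20, h21, h12, hq, h22, hpdef, tendsto_const_nhds, hlim, this]
  · rw [mem_W35_self_iff hc]
    rw [tendsto_iff_entries] at hx
    have hf' := fun n => mem_conj_unip_iff.1 (hf n)
    have h10 : h 1 0 = 0 := tendsto_nhds_unique (hx 1 0) (by simp [fun n => (hf' n).2.2.2.1])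
    have h20 : h 2 0 = 0 := tendsto_nhds_unique (hx 2 0) (by simp [fun n => (hf' n).2.2.2.2.1])
    have h21 : h 2 1 = 0 := tendsto_nhds_unique (hx 2 1) (by simp [fun n => (hf' n).2.2.2.2.2.1])
    have h12 : h 1 2 = 0 := tendsto_nhds_unique (hx 1 2)
      (by simp [fun n => (hf' n).2.2.2.2.2.2.2])
    refine ⟨?_, ?_, h10, h20, h21, h12⟩
    · refine pos_of_upper_limit hx (fun n i => ?_) h10 h20 h21 0
      fin_cases i
      exacts [(hf' n).1, (hf' n).2.1, (hf' n).2.2.1]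
    · refine eq_of_sub_eq_zero (eq_zero_of_mul_tendsto (x := h 0 1) hφ ((hx 1 1).sub (hx 0 0)) ?_)
      exact (hx 0 1).congr fun n => (hf' n).2.2.2.2.2.2.1

lemma tendsto_unip_right {c : ℝ} (hc : c ≠ 0) :
    ChabautyTendsto (fun n : ℕ => conj (unip 0 n) W31) (W36 (-2 * c) c) := by
  refine .of_eventually (fun h hh => ?_) (fun φ hφ f hf h hx => ?_)
  · rw [mem_W36_self_iff hc] at hh
    obtain ⟨hp, hq, h10, h20, h21, h01⟩ := hh
    have hd := det_of_upper h10 h20 h21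
    obtain ⟨p, hpdef⟩ : ∃ p, h 1 1 = p := ⟨_, rfl⟩
    rw [hpdef] at hp hq hd
    -- Here the last diagonal entry absorbs the perturbation and the first is forced by the
    -- determinant.
    have key : ∀ n : ℕ, ∃ g : G, 0 < p + h 1 2 / n → (g : Matrix (Fin 3) (Fin 3) ℝ) =
        !![(p * (p + h 1 2 / n))⁻¹, 0, h 0 2; 0, p, h 1 2; 0, 0, p + h 1 2 / n] := by
      intro n
      by_cases hn : 0 < p + h 1 2 / n
      · exact ⟨⟨_, by simp [Matrix.det_fin_three]; field_simp⟩, fun _ => rfl⟩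
      · exact ⟨1, fun h => absurd h hn⟩
    choose f hf using key
    have hlim := tendsto_add_div_natCast p (h 1 2)
    have hpos := hlim.eventually_const_lt hp
    refine ⟨f, ?_, ?_⟩
    · filter_upwards [hpos, eventually_ne_atTop 0] with n hn hn0
      rw [mem_conj_unip_iff, hf n hn]
      have : (n : ℝ) ≠ 0 := by exact_mod_cast hn0
      simp [hp, hn]
      field_simp
    · rw [tendsto_iff_entries]
      intro i j
      refine Tendsto.congr' (f₁ := fun n : ℕ => !![(p * (p + h 1 2 / n))⁻¹, 0, h 0 2; 0, p, h 1 2;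
        0, 0, p + h 1 2 / n] i j) (hpos.mono fun n hn => ?_) ?_
      · dsimp only
        rw [hf n hn]
      · have h00 : h 0 0 = (p * p)⁻¹ := by
          rw [hq, mul_assoc] at hd
          exact eq_inv_of_mul_eq_one_left hd
        have := (hlim.const_mul p).inv₀ (by positivity)
        fin_cases i <;> fin_cases j <;> simp only [Fin.zero_eta, Fin.mk_one, Fin.reduceFinMk,
          Matrix.of_apply, Matrix.cons_val, h10, h20, h21, h01, hq, h00, hpdef,
          tendsto_const_nhds, hlim, this]
  · rw [mem_W36_self_iff hc]
    rw [tendsto_iff_entries] at hx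
    have hf' := fun n => mem_conj_unip_iff.1 (hf n)
    have h10 : h 1 0 = 0 := tendsto_nhds_unique (hx 1 0) (by simp [fun n => (hf' n).2.2.2.1])
    have h20 : h 2 0 = 0 := tendsto_nhds_unique (hx 2 0) (by simp [fun n => (hf' n).2.2.2.2.1])
    have h21 : h 2 1 = 0 := tendsto_nhds_unique (hx 2 1) (by simp [fun n => (hf' n).2.2.2.2.2.1])
    have h01 : h 0 1 = 0 := tendsto_nhds_unique (hx 0 1)
      (by simp [fun n => (hf' n).2.2.2.2.2.2.1])
    refine ⟨?_, ?_, h10, h20, h21, h01⟩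
    · refine pos_of_upper_limit hx (fun n i => ?_) h10 h20 h21 1
      fin_cases i
      exacts [(hf' n).1, (hf' n).2.1, (hf' n).2.2.1]
    · refine eq_of_sub_eq_zero (eq_zero_of_mul_tendsto (x := h 1 2) hφ ((hx 2 2).sub (hx 1 1)) ?_)
      exact (hx 1 2).congr fun n => (hf' n).2.2.2.2.2.2.2

end Explicit

/-! ### Iwasawa decomposition and compactness of the rotations -/

section Iwasawa

lemma exists_rotation (x y : ℝ) :
    ∃ c s : ℝ, c * c + s * s = 1 ∧ -s * x + c * y = 0 ∧ 0 ≤ c * x + s * y := by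
  by_cases h : x ^ 2 + y ^ 2 = 0
  · have hx : x = 0 := by nlinarith [sq_nonneg x, sq_nonneg y]
    have hy : y = 0 := by nlinarith [sq_nonneg x, sq_nonneg y]
    exact ⟨1, 0, by simp, by simp [hy], by simp [hx]⟩
  · have hpos : 0 < x ^ 2 + y ^ 2 := lt_of_le_of_ne (by positivity) (Ne.symm h)
    have hr := Real.sqrt_pos.2 hpos
    have hr2 := Real.sq_sqrt hpos.le
    refine ⟨x / √(x ^ 2 + y ^ 2), y / √(x ^ 2 + y ^ 2), ?_, by ring, ?_⟩
    · field_simp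
      rw [hr2]
    · have : x / √(x ^ 2 + y ^ 2) * x + y / √(x ^ 2 + y ^ 2) * y =
          (x ^ 2 + y ^ 2) / √(x ^ 2 + y ^ 2) := by ring
      rw [this]
      positivity

/-- Rotation in the plane of the first two coordinates. -/
def rotLeft (c s : ℝ) (h : c * c + s * s = 1) : G :=
  ⟨!![c, s, 0; -s, c, 0; 0, 0, 1], by simp [Matrix.det_fin_three, h]⟩

/-- Rotation in the plane of the last two coordinates. -/
def rotRight (c s : ℝ) (h : c * c + s * s = 1) : G :=
  ⟨!![1, 0, 0; 0, c, s; 0, -s, c], by simp [Matrix.det_fin_three, h]⟩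

lemma rotLeft_mem (c s : ℝ) (h : c * c + s * s = 1) :
    (rotLeft c s h : Matrix (Fin 3) (Fin 3) ℝ) ∈ Matrix.orthogonalGroup (Fin 3) ℝ := by
  rw [Matrix.mem_orthogonalGroup_iff]
  ext i j
  fin_cases i <;> fin_cases j <;>
    simp [rotLeft, Matrix.mul_apply, Fin.sum_univ_three] <;> linarith

lemma rotRight_mem (c s : ℝ) (h : c * c + s * s = 1) :
    (rotRight c s h : Matrix (Fin 3) (Fin 3) ℝ) ∈ Matrix.orthogonalGroup (Fin 3) ℝ := by
  rw [Matrix.mem_orthogonalGroup_iff]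
  ext i j
  fin_cases i <;> fin_cases j <;>
    simp [rotRight, Matrix.mul_apply, Fin.sum_univ_three] <;> linarith

lemma rotLeft_mul (c s : ℝ) (h : c * c + s * s = 1) (g : G) :
    (∀ j, (rotLeft c s h * g) 0 j = c * g 0 j + s * g 1 j) ∧
    (∀ j, (rotLeft c s h * g) 1 j = -s * g 0 j + c * g 1 j) ∧
    (∀ j, (rotLeft c s h * g) 2 j = g 2 j) := by
  refine ⟨fun j => ?_, fun j => ?_, fun j => ?_⟩ <;>
    rw [Matrix.SpecialLinearGroup.coe_mul, Matrix.mul_apply, Fin.sum_univ_three] <;> simp [rotLeft]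

lemma rotRight_mul (c s : ℝ) (h : c * c + s * s = 1) (g : G) :
    (∀ j, (rotRight c s h * g) 0 j = g 0 j) ∧
    (∀ j, (rotRight c s h * g) 1 j = c * g 1 j + s * g 2 j) ∧
    (∀ j, (rotRight c s h * g) 2 j = -s * g 1 j + c * g 2 j) := by
  refine ⟨fun j => ?_, fun j => ?_, fun j => ?_⟩ <;>
    rw [Matrix.SpecialLinearGroup.coe_mul, Matrix.mul_apply, Fin.sum_univ_three] <;> simp [rotRight]

/-- Three Givens rotations clear the entries (2,0), (1,0) and (2,1) in this order; the last one
mixes rows whose first entries are already zero. The rotations make two diagonal entries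
nonnegative, and determinant one makes all three positive. -/
lemma exists_orthogonal_mul_upper (g : G) :
    ∃ k : G, (k : Matrix (Fin 3) (Fin 3) ℝ) ∈ Matrix.orthogonalGroup (Fin 3) ℝ ∧
      0 < (k * g) 0 0 ∧ 0 < (k * g) 1 1 ∧ 0 < (k * g) 2 2 ∧
      (k * g) 1 0 = 0 ∧ (k * g) 2 0 = 0 ∧ (k * g) 2 1 = 0 := by
  obtain ⟨c₁, s₁, h₁, z₁, -⟩ := exists_rotation (g 1 0) (g 2 0)
  obtain ⟨a0, a1, a2⟩ := rotRight_mul c₁ s₁ h₁ g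
  have m₁ := rotRight_mem c₁ s₁ h₁
  generalize rotRight c₁ s₁ h₁ = k₁ at *
  obtain ⟨c₂, s₂, h₂, z₂, p₂⟩ := exists_rotation ((k₁ * g) 0 0) ((k₁ * g) 1 0)
  obtain ⟨b0, b1, b2⟩ := rotLeft_mul c₂ s₂ h₂ (k₁ * g)
  have m₂ := rotLeft_mem c₂ s₂ h₂
  generalize rotLeft c₂ s₂ h₂ = k₂ at *
  obtain ⟨c₃, s₃, h₃, z₃, p₃⟩ := exists_rotation ((k₂ * (k₁ * g)) 1 1) ((k₂ * (k₁ * g)) 2 1)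
  obtain ⟨d0, d1, d2⟩ := rotRight_mul c₃ s₃ h₃ (k₂ * (k₁ * g))
  have m₃ := rotRight_mem c₃ s₃ h₃
  generalize rotRight c₃ s₃ h₃ = k₃ at *
  refine ⟨k₃ * (k₂ * k₁), ?_, ?_⟩
  · exact mul_mem m₃ (mul_mem m₂ m₁)
  · rw [show k₃ * (k₂ * k₁) * g = k₃ * (k₂ * (k₁ * g)) by simp [mul_assoc]]
    have x20 : (k₂ * (k₁ * g)) 2 0 = 0 := by rw [b2, a2, z₁]
    have x10 : (k₂ * (k₁ * g)) 1 0 = 0 := by rw [b1, z₂]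
    have e10 : (k₃ * (k₂ * (k₁ * g))) 1 0 = 0 := by rw [d1, x10, x20]; ring
    have e20 : (k₃ * (k₂ * (k₁ * g))) 2 0 = 0 := by rw [d2, x10, x20]; ring
    have e21 : (k₃ * (k₂ * (k₁ * g))) 2 1 = 0 := by rw [d2, z₃]
    have hd := det_of_upper e10 e20 e21
    have e00 : 0 ≤ (k₃ * (k₂ * (k₁ * g))) 0 0 := by rw [d0, b0]; exact p₂
    have e11 : 0 ≤ (k₃ * (k₂ * (k₁ * g))) 1 1 := by rw [d1]; exact p₃
    have f00 := e00.lt_of_ne' (fun h => by simp [h] at hd)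
    have f11 := e11.lt_of_ne' (fun h => by simp [h] at hd)
    refine ⟨f00, f11, ?_, e10, e20, e21⟩
    refine pos_of_mul_pos_right (a := (k₃ * (k₂ * (k₁ * g))) 0 0 * (k₃ * (k₂ * (k₁ * g))) 1 1) ?_ ?_
    · rw [hd]; exact one_pos
    · positivity

lemma exists_conj_eq_conj_unip (g : G) :
    ∃ k : G, (k : Matrix (Fin 3) (Fin 3) ℝ) ∈ Matrix.orthogonalGroup (Fin 3) ℝ ∧
      ∃ t s : ℝ, conj k (conj g W31) = conj (unip t s) W31 := by
  obtain ⟨k, hk, h00, h11, h22, h10, h20, h21⟩ := exists_orthogonal_mul_upper g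
  -- Elements of `W31` have zero superdiagonal, so `b = unip t s * w` forces `t = b 0 1 / b 1 1` and
  -- `s = b 1 2 / b 2 2`; the corner entry is absorbed by `w`.
  refine ⟨k, hk, (k * g) 0 1 / (k * g) 1 1, (k * g) 1 2 / (k * g) 2 2, ?_⟩
  rw [conj_conj]
  generalize k * g = b at *
  obtain ⟨w, hw⟩ : ∃ w, w = (unip (b 0 1 / b 1 1) (b 1 2 / b 2 2))⁻¹ * b := ⟨_, rfl⟩
  have hmem : w ∈ W31 := by
    rw [mem_W31_iff, hw]
    simp only [Matrix.SpecialLinearGroup.coe_mul, coe_unip_inv, Matrix.mul_apply,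
      Fin.sum_univ_three]
    simp [h10, h20, h21, h00, h11, h22]
    constructor
    · field_simp; ring
    · field_simp; ring
  generalize unip (b 0 1 / b 1 1) (b 1 2 / b 2 2) = u at *
  rw [← mul_inv_cancel_left u b, ← hw, ← conj_conj, conj_of_mem hmem]

lemma exists_tendsto_subseq_of_orthogonal (k : ℕ → G)
    (hk : ∀ n, (k n : Matrix (Fin 3) (Fin 3) ℝ) ∈ Matrix.orthogonalGroup (Fin 3) ℝ) :
    ∃ k₀ : G, (k₀ : Matrix (Fin 3) (Fin 3) ℝ) ∈ Matrix.orthogonalGroup (Fin 3) ℝ ∧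
      ∃ φ : ℕ → ℕ, StrictMono φ ∧ Tendsto (fun n => k (φ n)) atTop (𝓝 k₀) := by
  have hc : IsCompact (Matrix.orthogonalGroup (Fin 3) ℝ : Set (Matrix (Fin 3) (Fin 3) ℝ)) := by
    have hK : IsCompact (Set.univ.pi fun _ : Fin 3 => Set.univ.pi fun _ : Fin 3 =>
        Set.Icc (-1 : ℝ) 1) :=
      isCompact_univ_pi fun _ => isCompact_univ_pi fun _ => isCompact_Icc
    refine hK.of_isClosed_subset ?_ fun A hA i _ j _ => ?_
    · have : (Matrix.orthogonalGroup (Fin 3) ℝ : Set (Matrix (Fin 3) (Fin 3) ℝ)) =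
          {A | A * A.transpose = 1} := by
        ext A
        exact Matrix.mem_orthogonalGroup_iff (Fin 3) ℝ
      rw [this]
      exact isClosed_eq (continuous_id.matrix_mul continuous_id.matrix_transpose) continuous_const
    · exact abs_le.1 (entry_norm_bound_of_unitary (𝕜 := ℝ) hA i j)
  have : FirstCountableTopology (Matrix (Fin 3) (Fin 3) ℝ) :=
    inferInstanceAs (FirstCountableTopology (Fin 3 → Fin 3 → ℝ))
  obtain ⟨A, hA, φ, hφ, hlim⟩ := hc.tendsto_subseq hk
  have hemb := Matrix.SpecialLinearGroup.isClosedEmbedding_val (R := ℝ) (n := Fin 3)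
  obtain ⟨k₀, rfl⟩ := hemb.isClosed_range.mem_of_tendsto hlim
    (Eventually.of_forall fun n => ⟨k (φ n), rfl⟩)
  exact ⟨k₀, hA, φ, hφ, hemb.isEmbedding.tendsto_nhds_iff.2 hlim⟩

lemma exists_unip_limit {g : ℕ → G} {L : Subgroup G}
    (hL : ChabautyTendsto (fun n => conj (g n) W31) L) :
    ∃ k : G, (k : Matrix (Fin 3) (Fin 3) ℝ) ∈ Matrix.orthogonalGroup (Fin 3) ℝ ∧
      ∃ t s : ℕ → ℝ, ChabautyTendsto (fun n => conj (unip (t n) (s n)) W31) (conj k⁻¹ L) := by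
  choose k hk t s hts using fun n => exists_conj_eq_conj_unip (g n)
  obtain ⟨k₀, hk₀, φ, hφ, hlim⟩ := exists_tendsto_subseq_of_orthogonal k hk
  refine ⟨k₀⁻¹, ?_, fun n => t (φ n), fun n => s (φ n), ?_⟩
  · have h1 : ((k₀⁻¹ : G) : Matrix (Fin 3) (Fin 3) ℝ) * k₀ = 1 := by
      rw [← Matrix.SpecialLinearGroup.coe_mul, inv_mul_cancel, Matrix.SpecialLinearGroup.coe_one]
    rw [left_inv_eq_right_inv h1 (Unitary.mul_star_self_of_mem hk₀)]
    exact Unitary.star_mem hk₀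
  · have := (hL.comp_strictMono hφ).conj hlim
    simpa only [hts, inv_inv] using this

end Iwasawa

/-! ### Connectedness and realization of the singular groups -/

section Connected

lemma isPreconnected_W35 (a b : ℝ) : IsPreconnected (W35 a b : Set G) := by
  let F : ℝ × ℝ × ℝ → G := fun v => ⟨!![Real.exp (a * v.1), v.2.1, v.2.2;
    0, Real.exp (b * v.1), 0; 0, 0, Real.exp (-(a + b) * v.1)], by
      simp [Matrix.det_fin_three, ← Real.exp_add]; ring⟩
  have hF : Continuous F := by
    refine Continuous.subtype_mk (continuous_matrix fun i j => ?_) _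
    fin_cases i <;> fin_cases j <;> simp <;> fun_prop
  have : (W35 a b : Set G) = Set.range F := by
    ext h
    constructor
    · rintro ⟨t, x, y, hM⟩
      exact ⟨(t, x, y), Subtype.ext hM.symm⟩
    · rintro ⟨⟨t, x, y⟩, rfl⟩
      exact ⟨t, x, y, rfl⟩
  rw [this]
  exact isPreconnected_range hF

lemma isPreconnected_W36 (a b : ℝ) : IsPreconnected (W36 a b : Set G) := by
  let F : ℝ × ℝ × ℝ → G := fun v => ⟨!![Real.exp (a * v.1), 0, v.2.1;
    0, Real.exp (b * v.1), v.2.2; 0, 0, Real.exp (-(a + b) * v.1)], by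
      simp [Matrix.det_fin_three, ← Real.exp_add]; ring⟩
  have hF : Continuous F := by
    refine Continuous.subtype_mk (continuous_matrix fun i j => ?_) _
    fin_cases i <;> fin_cases j <;> simp <;> fun_prop
  have : (W36 a b : Set G) = Set.range F := by
    ext h
    constructor
    · rintro ⟨t, x, y, hM⟩
      exact ⟨(t, x, y), Subtype.ext hM.symm⟩
    · rintro ⟨⟨t, x, y⟩, rfl⟩
      exact ⟨t, x, y, rfl⟩
  rw [this]
  exact isPreconnected_range hF

lemma isLocalLimit_of_tendsto {H L : Subgroup G} {g : ℕ → G}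
    (hL : ChabautyTendsto (fun n => conj (g n) H) L) (hc : IsPreconnected (L : Set G)) :
    IsLocalLimit H L :=
  ⟨g, L, hL, (hc.connectedComponentIn L.one_mem).symm⟩

lemma ChabautyTendsto.conj_left {H L : Subgroup G} {g : ℕ → G}
    (hL : ChabautyTendsto (fun n => SL3Limits.conj (g n) H) L) (k : G) :
    ChabautyTendsto (fun n => SL3Limits.conj (k * g n) H) (SL3Limits.conj k L) := by
  simpa only [conj_conj] using hL.conj (tendsto_const_nhds (x := k))

/-- The signed permutation exchanging the last two coordinates. -/
def swapRight : G := rotRight 0 1 (by norm_num)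

/-- The signed permutation exchanging the first two coordinates. -/
def swapLeft : G := rotLeft 0 1 (by norm_num)

/-- Exchanging the last two coordinates turns the weights `(c, c, -2c)` into `(c, -2c, c)`. The sign
that gives the permutation determinant one reappears in the witnesses. -/
lemma conj_swapRight_W35 (c : ℝ) : conj swapRight (W35 c c) = W35 c (-2 * c) := by
  have hle : ∀ h ∈ W35 c (-2 * c), h ∈ conj swapRight (W35 c c) := by
    rintro h ⟨t, x, y, hM⟩
    rw [mem_conj_iff]
    refine ⟨t, -y, x, ?_⟩
    rw [Matrix.SpecialLinearGroup.coe_mul, Matrix.SpecialLinearGroup.coe_mul,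
      Matrix.SpecialLinearGroup.coe_inv, hM, Matrix.adjugate_fin_three]
    ext i j
    fin_cases i <;> fin_cases j <;>
      simp [swapRight, rotRight, Matrix.mul_apply, Fin.sum_univ_three] <;> ring_nf <;> simp
  refine le_antisymm ?_ hle
  rintro _ ⟨h, ⟨t, x, y, hM⟩, rfl⟩
  refine ⟨t, y, -x, ?_⟩
  simp only [MulEquiv.toMonoidHom_eq_coe, MonoidHom.coe_coe, MulAut.conj_apply]
  rw [Matrix.SpecialLinearGroup.coe_mul, Matrix.SpecialLinearGroup.coe_mul,
    Matrix.SpecialLinearGroup.coe_inv, hM, Matrix.adjugate_fin_three]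
  ext i j
  fin_cases i <;> fin_cases j <;>
    simp [swapRight, rotRight, Matrix.mul_apply, Fin.sum_univ_three] <;> ring_nf <;> simp

lemma conj_swapLeft_W36 (c : ℝ) : conj swapLeft (W36 (-2 * c) c) = W36 c (-2 * c) := by
  have hle : ∀ h ∈ W36 c (-2 * c), h ∈ conj swapLeft (W36 (-2 * c) c) := by
    rintro h ⟨t, x, y, hM⟩
    rw [mem_conj_iff]
    refine ⟨t, -y, x, ?_⟩
    rw [Matrix.SpecialLinearGroup.coe_mul, Matrix.SpecialLinearGroup.coe_mul,
      Matrix.SpecialLinearGroup.coe_inv, hM, Matrix.adjugate_fin_three]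
    ext i j
    fin_cases i <;> fin_cases j <;>
      simp [swapLeft, rotLeft, Matrix.mul_apply, Fin.sum_univ_three] <;> ring_nf <;> simp
  refine le_antisymm ?_ hle
  rintro _ ⟨h, ⟨t, x, y, hM⟩, rfl⟩
  refine ⟨t, y, -x, ?_⟩
  simp only [MulEquiv.toMonoidHom_eq_coe, MonoidHom.coe_coe, MulAut.conj_apply]
  rw [Matrix.SpecialLinearGroup.coe_mul, Matrix.SpecialLinearGroup.coe_mul,
    Matrix.SpecialLinearGroup.coe_inv, hM, Matrix.adjugate_fin_three]
  ext i j
  fin_cases i <;> fin_cases j <;>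
    simp [swapLeft, rotLeft, Matrix.mul_apply, Fin.sum_univ_three] <;> ring_nf <;> simp

lemma isLocalLimit_W35 {a b : ℝ} (hab : (a, b) ≠ (0, 0)) (h : a = b ∨ a = -(a + b)) :
    IsLocalLimit W31 (W35 a b) := by
  rcases h with rfl | h
  · have ha : a ≠ 0 := by rintro rfl; exact hab rfl
    exact isLocalLimit_of_tendsto (tendsto_unip_left ha) (isPreconnected_W35 a a)
  · obtain rfl : b = -2 * a := by linarith
    have ha : a ≠ 0 := by rintro rfl; simp at hab
    have := (tendsto_unip_left ha).conj_left swapRight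
    rw [conj_swapRight_W35] at this
    exact isLocalLimit_of_tendsto this (isPreconnected_W35 _ _)

lemma isLocalLimit_W36 {a b : ℝ} (hab : (a, b) ≠ (0, 0)) (h : a = -(a + b) ∨ b = -(a + b)) :
    IsLocalLimit W31 (W36 a b) := by
  rcases h with h | h
  · obtain rfl : b = -2 * a := by linarith
    have ha : a ≠ 0 := by rintro rfl; simp at hab
    have := (tendsto_unip_right ha).conj_left swapLeft
    rw [conj_swapLeft_W36] at this
    exact isLocalLimit_of_tendsto this (isPreconnected_W36 _ _)
  · obtain rfl : a = -2 * b := by linarith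
    have hb : b ≠ 0 := by rintro rfl; simp at hab
    exact isLocalLimit_of_tendsto (tendsto_unip_right hb) (isPreconnected_W36 _ _)

end Connected

/-! ### Obstruction: which weights can occur in a limit -/

section Obstruction

/-- The unipotent matrix `I + E₁₃`. -/
def unipCorner : G := ⟨!![1, 0, 1; 0, 1, 0; 0, 0, 1], by simp [Matrix.det_fin_three]⟩

lemma coe_unipCorner :
    (unipCorner : Matrix (Fin 3) (Fin 3) ℝ) = !![1, 0, 1; 0, 1, 0; 0, 0, 1] := rfl

lemma unip_mem_W35 (a b : ℝ) : unip 1 0 ∈ W35 a b := ⟨0, 1, 0, by simp [coe_unip]⟩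

lemma unipCorner_mem_W35 (a b : ℝ) : unipCorner ∈ W35 a b := ⟨0, 0, 1, by simp [coe_unipCorner]⟩

lemma unip_mem_W36 (a b : ℝ) : unip 0 1 ∈ W36 a b := ⟨0, 0, 1, by simp [coe_unip]⟩

lemma unipCorner_mem_W36 (a b : ℝ) : unipCorner ∈ W36 a b := ⟨0, 1, 0, by simp [coe_unipCorner]⟩

/-- The relation `(h - 1)² = 0` survives conjugation, and the diagonal of the square of an upper
triangular matrix consists of the squared diagonal entries. -/
lemma diag_eq_one_of_conj {g h : G}
    (hu : ((h : Matrix (Fin 3) (Fin 3) ℝ) - 1) * ((h : Matrix (Fin 3) (Fin 3) ℝ) - 1) = 0)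
    (h10 : (g⁻¹ * h * g) 1 0 = 0) (h20 : (g⁻¹ * h * g) 2 0 = 0) (h21 : (g⁻¹ * h * g) 2 1 = 0) :
    (g⁻¹ * h * g) 0 0 = 1 ∧ (g⁻¹ * h * g) 1 1 = 1 ∧ (g⁻¹ * h * g) 2 2 = 1 := by
  have hg : (g : Matrix (Fin 3) (Fin 3) ℝ) * (g⁻¹ : G) = 1 := by
    rw [← Matrix.SpecialLinearGroup.coe_mul, mul_inv_cancel, Matrix.SpecialLinearGroup.coe_one]
  have hg' : ((g⁻¹ : G) : Matrix (Fin 3) (Fin 3) ℝ) * g = 1 := by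
    rw [← Matrix.SpecialLinearGroup.coe_mul, inv_mul_cancel, Matrix.SpecialLinearGroup.coe_one]
  have e : ((g⁻¹ * h * g : G) : Matrix (Fin 3) (Fin 3) ℝ) - 1 = (g⁻¹ : G).1 * (h.1 - 1) * g.1 := by
    rw [Matrix.SpecialLinearGroup.coe_mul, Matrix.SpecialLinearGroup.coe_mul, mul_sub, sub_mul,
      mul_one, hg']
  have hsq : (((g⁻¹ * h * g : G) : Matrix (Fin 3) (Fin 3) ℝ) - 1) *
      (((g⁻¹ * h * g : G) : Matrix (Fin 3) (Fin 3) ℝ) - 1) = 0 := by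
    rw [e]
    calc (g⁻¹ : G).1 * (h.1 - 1) * g.1 * ((g⁻¹ : G).1 * (h.1 - 1) * g.1)
        = (g⁻¹ : G).1 * (h.1 - 1) * (g.1 * (g⁻¹ : G).1) * (h.1 - 1) * g.1 := by
          simp only [mul_assoc]
      _ = 0 := by rw [hg, mul_one, mul_assoc (g⁻¹ : G).1, hu]; simp
  generalize g⁻¹ * h * g = M at *
  have key : ∀ i, ((M : Matrix (Fin 3) (Fin 3) ℝ) i i - 1) ^ 2 = 0 := by
    intro i
    have := congrFun (congrFun hsq i) i
    rw [Matrix.mul_apply, Fin.sum_univ_three] at this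
    fin_cases i <;> simp [h10, h20, h21] at this ⊢ <;> exact this
  exact ⟨sub_eq_zero.1 (pow_eq_zero_iff two_ne_zero |>.1 (key 0)),
    sub_eq_zero.1 (pow_eq_zero_iff two_ne_zero |>.1 (key 1)),
    sub_eq_zero.1 (pow_eq_zero_iff two_ne_zero |>.1 (key 2))⟩

lemma unip_sub_one_sq {t s : ℝ} (h : t * s = 0) :
    ((unip t s : Matrix (Fin 3) (Fin 3) ℝ) - 1) * ((unip t s : Matrix (Fin 3) (Fin 3) ℝ) - 1) =
      0 := by
  rw [coe_unip]
  ext i j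
  fin_cases i <;> fin_cases j <;> simp [Matrix.mul_apply, Fin.sum_univ_three, h]

lemma unipCorner_sub_one_sq :
    ((unipCorner : Matrix (Fin 3) (Fin 3) ℝ) - 1) * ((unipCorner : Matrix (Fin 3) (Fin 3) ℝ) - 1) =
      0 := by
  rw [coe_unipCorner]
  ext i j
  fin_cases i <;> fin_cases j <;> simp [Matrix.mul_apply, Fin.sum_univ_three]

lemma trace_conj (g h : G) :
    (g⁻¹ * h * g) 0 0 + (g⁻¹ * h * g) 1 1 + (g⁻¹ * h * g) 2 2 = h 0 0 + h 1 1 + h 2 2 := by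
  have : Matrix.trace (g⁻¹ * h * g : G).1 = Matrix.trace h.1 := by
    rw [Matrix.SpecialLinearGroup.coe_mul, Matrix.trace_mul_comm,
      ← Matrix.SpecialLinearGroup.coe_mul]
    simp
  simpa [Matrix.trace_fin_three] using this

lemma entry_mul (g h : G) (i j : Fin 3) :
    (g * h) i j = g i 0 * h 0 j + g i 1 * h 1 j + g i 2 * h 2 j := by
  rw [Matrix.SpecialLinearGroup.coe_mul, Matrix.mul_apply, Fin.sum_univ_three]

/-- If `A`, `B`, `C` are the eigenvalues of a matrix of determinant one which also has the
eigenvalues `A`, `A`, `m`, then `A` occurs twice among `A`, `B`, `C`. -/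
lemma eq_or_eq_of_double_root {A B C m : ℝ} (hA : A ≠ 0) (h1 : A * B * C = 1) (h2 : A * A * m = 1)
    (h3 : A + A + m = A + B + C) : A = B ∨ A = C := by
  -- Substituting `B + C = A + m` leaves `A * B * C - A * A * m`, a difference of two ones.
  have : A * ((A - B) * (A - C)) = 0 := by
    linear_combination h1 - h2 + A * A * h3
  rcases mul_eq_zero.1 ((mul_eq_zero.1 this).resolve_left hA) with h | h
  · exact .inl (sub_eq_zero.1 h)
  · exact .inr (sub_eq_zero.1 h)

variable {K : Subgroup G} {g : G} {a b : ℝ}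

/-- By `h g = g (g⁻¹ h g)`, the elements `I + E₁₂` and `I + E₁₃` fix the first two columns of `g`.
Both columns are then multiples of the first basis vector, so `g` is singular. -/
lemma not_W35_of_entry_eq_zero (hK : ∀ h ∈ K, h 1 0 = 0 ∧ h 2 0 = 0 ∧ h 2 1 = 0)
    (hg : ∀ h ∈ W35 a b, g⁻¹ * h * g ∈ K) (hz : ∀ h ∈ K, h 0 0 = h 1 1 → h 0 1 = 0) : False := by
  have key : ∀ h ∈ W35 a b,
      ((h : Matrix (Fin 3) (Fin 3) ℝ) - 1) * ((h : Matrix (Fin 3) (Fin 3) ℝ) - 1) = 0 →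
      (h * g) 0 0 = g 0 0 ∧ (h * g) 0 1 = g 0 1 := by
    intro h hh hu
    obtain ⟨h10, h20, h21⟩ := hK _ (hg h hh)
    obtain ⟨h00, h11, h22⟩ := diag_eq_one_of_conj hu h10 h20 h21
    have h01 := hz _ (hg h hh) (h00.trans h11.symm)
    have e : h * g = g * (g⁻¹ * h * g) := by group
    rw [e, entry_mul g, entry_mul g, h00, h10, h20, h01, h11, h21]
    simp
  obtain ⟨p0, p1⟩ := key _ (unip_mem_W35 a b) (unip_sub_one_sq (by simp))
  obtain ⟨q0, q1⟩ := key _ (unipCorner_mem_W35 a b) unipCorner_sub_one_sq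
  simp [entry_mul, coe_unip, coe_unipCorner] at p0 p1 q0 q1
  have := g.det_coe
  rw [Matrix.det_fin_three] at this
  simp [p0, p1, q0, q1] at this

/-- Dually, the last two rows of `g⁻¹` are fixed from the right by `I + E₂₃` and `I + E₁₃`, hence
are multiples of the last basis row. -/
lemma not_W36_of_entry_eq_zero (hK : ∀ h ∈ K, h 1 0 = 0 ∧ h 2 0 = 0 ∧ h 2 1 = 0)
    (hg : ∀ h ∈ W36 a b, g⁻¹ * h * g ∈ K) (hz : ∀ h ∈ K, h 1 1 = h 2 2 → h 1 2 = 0) : False := by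
  have key : ∀ h ∈ W36 a b,
      ((h : Matrix (Fin 3) (Fin 3) ℝ) - 1) * ((h : Matrix (Fin 3) (Fin 3) ℝ) - 1) = 0 →
      (g⁻¹ * h) 1 2 = g⁻¹ 1 2 ∧ (g⁻¹ * h) 2 2 = g⁻¹ 2 2 := by
    intro h hh hu
    obtain ⟨h10, h20, h21⟩ := hK _ (hg h hh)
    obtain ⟨h00, h11, h22⟩ := diag_eq_one_of_conj hu h10 h20 h21
    have h12 := hz _ (hg h hh) (h11.trans h22.symm)
    have e : g⁻¹ * h = (g⁻¹ * h * g) * g⁻¹ := by group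
    rw [e, entry_mul _ g⁻¹, entry_mul _ g⁻¹, h10, h20, h12, h11, h21, h22]
    simp only [zero_mul, one_mul, zero_add, add_zero, and_self]
  obtain ⟨p0, p1⟩ := key _ (unip_mem_W36 a b) (unip_sub_one_sq (by simp))
  obtain ⟨q0, q1⟩ := key _ (unipCorner_mem_W36 a b) unipCorner_sub_one_sq
  generalize g⁻¹ = k at *
  simp [entry_mul, coe_unip, coe_unipCorner] at p0 p1 q0 q1
  have := k.det_coe
  rw [Matrix.det_fin_three] at this
  simp [p0, p1, q0, q1] at this

/-- The first column of `g` is a common eigenvector of `W35 a b`. Being fixed by the unipotents, it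
spans the first axis, so its eigenvalue at `t = 1` is `exp a`; equality of the first two diagonal
entries in `K` makes this a double eigenvalue. -/
lemma weights_of_W35 (hK : ∀ h ∈ K, h 1 0 = 0 ∧ h 2 0 = 0 ∧ h 2 1 = 0)
    (hg : ∀ h ∈ W35 a b, g⁻¹ * h * g ∈ K) (he : ∀ h ∈ K, h 0 0 = h 1 1) :
    a = b ∨ a = -(a + b) := by
  have key : ∀ h ∈ W35 a b, (h * g) 0 0 = g 0 0 * (g⁻¹ * h * g) 0 0 := by
    intro h hh
    obtain ⟨h10, h20, h21⟩ := hK _ (hg h hh)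
    have e : h * g = g * (g⁻¹ * h * g) := by group
    rw [e, entry_mul g, h10, h20]
    simp
  have key' : ∀ h ∈ W35 a b,
      ((h : Matrix (Fin 3) (Fin 3) ℝ) - 1) * ((h : Matrix (Fin 3) (Fin 3) ℝ) - 1) = 0 →
      (h * g) 0 0 = g 0 0 := by
    intro h hh hu
    obtain ⟨h10, h20, h21⟩ := hK _ (hg h hh)
    rw [key h hh, (diag_eq_one_of_conj hu h10 h20 h21).1, mul_one]
  have g10 := key' _ (unip_mem_W35 a b) (unip_sub_one_sq (by simp))
  have g20 := key' _ (unipCorner_mem_W35 a b) unipCorner_sub_one_sq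
  simp [entry_mul, coe_unip, coe_unipCorner] at g10 g20
  have g00 : g 0 0 ≠ 0 := by
    intro g00
    have := g.det_coe
    rw [Matrix.det_fin_three] at this
    simp [g00, g10, g20] at this
  obtain ⟨h, hM⟩ : ∃ h : G, (h : Matrix (Fin 3) (Fin 3) ℝ) =
      !![Real.exp a, 0, 0; 0, Real.exp b, 0; 0, 0, Real.exp (-(a + b))] :=
    ⟨⟨_, by simp [Matrix.det_fin_three, ← Real.exp_add]⟩, rfl⟩
  have hh : h ∈ W35 a b := ⟨1, 0, 0, by simpa using hM⟩
  have h1 := key h hh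
  obtain ⟨h10, h20, h21⟩ := hK _ (hg h hh)
  have h3 := trace_conj g h
  have h2 := det_of_upper h10 h20 h21
  rw [← he _ (hg h hh)] at h2 h3
  rw [entry_mul h, mul_comm (g 0 0)] at h1
  simp only [hM, Matrix.of_apply, Matrix.cons_val, zero_mul, add_zero] at h1 h3
  rw [← mul_right_cancel₀ g00 h1] at h2 h3
  rcases eq_or_eq_of_double_root (Real.exp_ne_zero a) (by simp [← Real.exp_add]) h2 h3 with h | h
  · exact .inl (Real.exp_injective h)
  · exact .inr (Real.exp_injective h)

/-- Dually, the last row of `g⁻¹` is a left eigenvector along the last axis, so `exp (-(a + b))` is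
a double eigenvalue. -/
lemma weights_of_W36 (hK : ∀ h ∈ K, h 1 0 = 0 ∧ h 2 0 = 0 ∧ h 2 1 = 0)
    (hg : ∀ h ∈ W36 a b, g⁻¹ * h * g ∈ K) (he : ∀ h ∈ K, h 1 1 = h 2 2) :
    a = -(a + b) ∨ b = -(a + b) := by
  have key : ∀ h ∈ W36 a b, (g⁻¹ * h) 2 2 = (g⁻¹ * h * g) 2 2 * g⁻¹ 2 2 := by
    intro h hh
    obtain ⟨h10, h20, h21⟩ := hK _ (hg h hh)
    have e : g⁻¹ * h = (g⁻¹ * h * g) * g⁻¹ := by group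
    rw [e, entry_mul _ g⁻¹, ← e, h20, h21]
    simp only [zero_mul, zero_add]
  have key' : ∀ h ∈ W36 a b,
      ((h : Matrix (Fin 3) (Fin 3) ℝ) - 1) * ((h : Matrix (Fin 3) (Fin 3) ℝ) - 1) = 0 →
      (g⁻¹ * h) 2 2 = g⁻¹ 2 2 := by
    intro h hh hu
    obtain ⟨h10, h20, h21⟩ := hK _ (hg h hh)
    rw [key h hh, (diag_eq_one_of_conj hu h10 h20 h21).2.2, one_mul]
  have g21 := key' _ (unip_mem_W36 a b) (unip_sub_one_sq (by simp))
  have g20 := key' _ (unipCorner_mem_W36 a b) unipCorner_sub_one_sq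
  obtain ⟨h, hM⟩ : ∃ h : G, (h : Matrix (Fin 3) (Fin 3) ℝ) =
      !![Real.exp a, 0, 0; 0, Real.exp b, 0; 0, 0, Real.exp (-(a + b))] :=
    ⟨⟨_, by simp [Matrix.det_fin_three, ← Real.exp_add]⟩, rfl⟩
  have hh : h ∈ W36 a b := ⟨1, 0, 0, by simpa using hM⟩
  have h1 := key h hh
  obtain ⟨h10, h20, h21⟩ := hK _ (hg h hh)
  have h3 := trace_conj g h
  have h2 := det_of_upper h10 h20 h21
  rw [he _ (hg h hh)] at h2 h3
  have hk := (g⁻¹).det_coe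
  generalize (g⁻¹ * h * g) 2 2 = A at *
  generalize (g⁻¹ * h * g) 0 0 = m at *
  rw [entry_mul _ h] at h1
  clear key key' h10 h20 h21 he hg
  generalize g⁻¹ = k at *
  simp [entry_mul, coe_unip, coe_unipCorner] at g21 g20
  have g22 : k 2 2 ≠ 0 := by
    intro g22
    rw [Matrix.det_fin_three] at hk
    simp [g22, g21, g20] at hk
  simp only [hM, Matrix.of_apply, Matrix.cons_val, mul_zero, zero_add, mul_comm (k 2 2)] at h1 h3
  rw [← mul_right_cancel₀ g22 h1] at h2 h3
  rcases eq_or_eq_of_double_root (A := Real.exp (-(a + b))) (B := Real.exp a) (C := Real.exp b)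
    (m := m) (Real.exp_ne_zero _) (by simp [← Real.exp_add]) (by linarith) (by linarith) with h | h
  · exact .inl (Real.exp_injective h).symm
  · exact .inr (Real.exp_injective h).symm

/-- Only the inclusion of the identity component in the full limit is needed for the obstruction. -/
lemma IsLocalLimit.exists_unip {L : Subgroup G} (hL : IsLocalLimit W31 L) :
    ∃ (K : Subgroup G) (g : G) (t s : ℕ → ℝ), (∀ h ∈ L, g⁻¹ * h * g ∈ K) ∧
      ChabautyTendsto (fun n => conj (unip (t n) (s n)) W31) K := by
  obtain ⟨g, L', hL', hLL'⟩ := hL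
  obtain ⟨k, -, t, s, hts⟩ := exists_unip_limit hL'
  refine ⟨_, k, t, s, fun h hh => ?_, hts⟩
  rw [mem_conj_iff]
  have : h ∈ L' := connectedComponentIn_subset _ _ (hLL'.subset hh)
  simpa only [mul_assoc, inv_inv, mul_inv_cancel, mul_inv_cancel_left, mul_one] using this

lemma IsLocalLimit.weights_W35 (hL : IsLocalLimit W31 (W35 a b)) : a = b ∨ a = -(a + b) := by
  obtain ⟨K, g, t, s, hg, hK⟩ := hL.exists_unip
  by_cases ht : Bornology.IsBounded (Set.range t)
  · exact (not_W35_of_entry_eq_zero (fun h hh => upper_of_unip_limit hK hh) hg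
      fun h hh => entry_eq_zero_of_bounded_left hK ht hh).elim
  · exact weights_of_W35 (fun h hh => upper_of_unip_limit hK hh) hg
      fun h hh => entry_eq_of_unbounded_left hK ht hh

lemma IsLocalLimit.weights_W36 (hL : IsLocalLimit W31 (W36 a b)) :
    a = -(a + b) ∨ b = -(a + b) := by
  obtain ⟨K, g, t, s, hg, hK⟩ := hL.exists_unip
  by_cases hs : Bornology.IsBounded (Set.range s)
  · exact (not_W36_of_entry_eq_zero (fun h hh => upper_of_unip_limit hK hh) hg
      fun h hh => entry_eq_zero_of_bounded_right hK hs hh).elim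
  · exact weights_of_W36 (fun h hh => upper_of_unip_limit hK hh) hg
      fun h hh => entry_eq_of_unbounded_right hK hs hh

end Obstruction

end SL3Limits

open SL3Limits in
theorem mainTheorem5 :
    -- only singular groups occur
    (∀ a b : ℝ, (a, b) ≠ (0, 0) →
      SL3Limits.IsLocalLimit SL3Limits.W31 (SL3Limits.W35 a b) ∨
        SL3Limits.IsLocalLimit SL3Limits.W31 (SL3Limits.W36 a b) →
      SL3Limits.IsSingular a b) ∧
    -- which singular groups occur
    (∀ a b : ℝ, (a, b) ≠ (0, 0) →
      (SL3Limits.IsLocalLimit SL3Limits.W31 (SL3Limits.W35 a b) ↔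
        a = b ∨ a = -(a + b)) ∧
      (SL3Limits.IsLocalLimit SL3Limits.W31 (SL3Limits.W36 a b) ↔
        a = -(a + b) ∨ b = -(a + b))) ∧
    -- explicit realizations
    (∀ c : ℝ, c ≠ 0 →
      SL3Limits.ChabautyTendsto
        (fun n : ℕ => SL3Limits.conj (SL3Limits.unip n 0) SL3Limits.W31)
        (SL3Limits.W35 c c) ∧
      SL3Limits.ChabautyTendsto
        (fun n : ℕ => SL3Limits.conj (SL3Limits.unip 0 n) SL3Limits.W31)
        (SL3Limits.W36 (-2 * c) c)) ∧
    -- up to a rotation, every conjugation limit is a limit along unipotent matrices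
    (∀ (g : ℕ → SL3Limits.G) (L : Subgroup SL3Limits.G),
      SL3Limits.ChabautyTendsto (fun n => SL3Limits.conj (g n) SL3Limits.W31) L →
      ∃ k : SL3Limits.G,
        (k : Matrix (Fin 3) (Fin 3) ℝ) ∈ Matrix.orthogonalGroup (Fin 3) ℝ ∧
        ∃ t s : ℕ → ℝ,
          SL3Limits.ChabautyTendsto
            (fun n => SL3Limits.conj (SL3Limits.unip (t n) (s n)) SL3Limits.W31)
            (SL3Limits.conj k⁻¹ L)) ∧
    -- limits along unipotent matrices: two diagonal entries coincide if the sequence is unbounded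
    (∀ (t s : ℕ → ℝ) (L : Subgroup SL3Limits.G),
      SL3Limits.ChabautyTendsto
        (fun n => SL3Limits.conj (SL3Limits.unip (t n) (s n)) SL3Limits.W31) L →
      (∀ h ∈ L, h 1 0 = 0 ∧ h 2 0 = 0 ∧ h 2 1 = 0) ∧
      (¬ Bornology.IsBounded (Set.range t) → ∀ h ∈ L, h 0 0 = h 1 1) ∧
      (¬ Bornology.IsBounded (Set.range s) → ∀ h ∈ L, h 1 1 = h 2 2) ∧
      (Bornology.IsBounded (Set.range t) → Bornology.IsBounded (Set.range s) →
        ∃ p : SL3Limits.G, L = SL3Limits.conj p SL3Limits.W31)) := by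
  refine ⟨?_, fun a b hab => ⟨⟨fun h => h.weights_W35, isLocalLimit_W35 hab⟩,
    fun h => h.weights_W36, isLocalLimit_W36 hab⟩,
    fun c hc => ⟨tendsto_unip_left hc, tendsto_unip_right hc⟩,
    fun g L hL => exists_unip_limit hL, fun t s L hL => ⟨fun h hh => upper_of_unip_limit hL hh,
      fun ht h hh => entry_eq_of_unbounded_left hL ht hh,
      fun hs h hh => entry_eq_of_unbounded_right hL hs hh, exists_eq_conj_of_bounded hL⟩⟩
  rintro a b - (h | h)
  · exact h.weights_W35.imp_right .inl
  · exact .inr h.weights_W36
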